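/- For a finite group $G$, the generator exponent of $G$ is $$\mathrm{ge}(G):=\min_S\ \mathrm{lcm}\{\mathrm{ord}(x)\mid x\in S\},$$ where $S$ ranges over all generating subsets of $G$. For a normal subgroup $N$ of a group $H$, a partial complement of $N$ in $H$ is a proper subgroup $U<H$ with $NU=H$. For a finite solvable group $G$, consider all series $(N_i,G_i)_{i=1,\dots,s}$ ($s\ge 0$) of subgroups such that, with $G_0:=G$, for each $i=1,\dots,s$ the group $N_i$ is a nilpotent normal subgroup of $G_{i-1}$ and $G_i$ is a partial complement of $N_i$ in $G_{i-1}$, and such that $G_s=\{1\}$. Define $$r(G):=\min\ \mathrm{lcm}(\exp(N_1),\dots,\exp(N_s)),$$ the minimum being taken over all such series (the empty lcm, which occurs only for $G=\{1\}$, is $1$). Theorem. Let $p$ be a prime and let $G$ be a finite $p$-group of nilpotency class $c\le p$. Then $r(G)=\mathrm{ge}(G)$. -/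

import Mathlib

open scoped Pointwise

/-- The values `lcm {ord x | x ∈ S}`, where `S` ranges over all generating subsets of the finite
group `G` (every subset of a finite group is finite, so `S` is taken to be a `Finset`). -/
def generatingLcms (G : Type*) [Group G] [Finite G] : Set ℕ :=
  {n | ∃ S : Finset G, Subgroup.closure (S : Set G) = ⊤ ∧ S.lcm orderOf = n}

/-- The generator exponent `ge(G)` of a finite group `G`: the minimum over all generating subsets
`S` of `G` of the least common multiple of the orders of the elements of `S`. -/
noncomputable def generatorExponent (G : Type*) [Group G] [Finite G] : ℕ :=
  sInf (generatingLcms G)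

/-- For subgroups `H`, `N`, `U` of an ambient group: `N` is a normal subgroup of `H`, and `U` is a
partial complement of `N` in `H`, that is, a proper subgroup of `H` with `N U = H`. -/
structure IsPartialComplementIn {G : Type*} [Group G] (H N U : Subgroup G) : Prop where
  le : N ≤ H
  normal : (N.subgroupOf H).Normal
  proper : U < H
  mul_eq : (N : Set G) * (U : Set G) = (H : Set G)

/-- A series `(N_i, G_i)`, `i = 1, …, s`, of nilpotent normal subgroups and partial complements:
`G_0 = G`, and for `i = 1, …, s` the group `N_i` is a nilpotent normal subgroup of `G_{i-1}` with
partial complement `G_i` in `G_{i-1}`, and `G_s = 1`. (As `G_i` is a proper subgroup of `G_{i-1}`,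
`s` is then automatically the smallest index with `G_s = 1`. The values of `grp` at indices
above `s` and those of `ker` at indices outside `1, …, s` are irrelevant.) -/
structure PartialComplementSeries (G : Type*) [Group G] where
  /-- the length `s` of the series -/
  length : ℕ
  /-- the subgroups `G_0, …, G_s` -/
  grp : ℕ → Subgroup G
  /-- the subgroups `N_1, …, N_s` -/
  ker : ℕ → Subgroup G
  grp_zero : grp 0 = ⊤
  grp_length : grp length = ⊥
  nilpotent : ∀ i < length, Group.IsNilpotent (ker (i + 1))
  isPartialComplementIn : ∀ i < length, IsPartialComplementIn (grp i) (ker (i + 1)) (grp (i + 1))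

/-- `lcm (e_1, …, e_s)`, where `e_i` is the exponent of `N_i`; it is `1` for `s = 0`. -/
noncomputable def PartialComplementSeries.lcmExponent {G : Type*} [Group G]
    (σ : PartialComplementSeries G) : ℕ :=
  (Finset.Icc 1 σ.length).lcm fun i => Monoid.exponent (σ.ker i)

/-- The constant `r(G)` of a finite solvable group `G`: the minimum of `lcm (e_1, …, e_s)` over all
series of nilpotent normal subgroups and partial complements. -/
noncomputable def shafarevichConstant (G : Type*) [Group G] [Finite G] : ℕ :=
  sInf (Set.range (PartialComplementSeries.lcmExponent (G := G)))

/-! In any series the `N_i` together generate `G`, so the elements whose order divides the lcm of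
their exponents generate `G`; hence `ge(G) ≤ r(G)`. Conversely, discard the elements of an optimal
generating set one at a time. If `H = ⟨x, S⟩` with `x ∉ ⟨S⟩`, the normal closure of `x` in `H` has
partial complement `⟨S⟩` and lies in `⟨x⟩H'`, whose class is less than `p`. In class less than `p`
the solutions of `g ^ p ^ e = 1` form a subgroup (`mul_pow_prime_pow_eq_one`), so this normal
closure has exponent dividing `p ^ e`. The case `e = 1` rests on `(xy)^p = x^p y^p` when `G'` has
exponent dividing `p`, proved with polynomial sequences. -/

open scoped commutatorElement

/-! ### Commutators in the lower central series. -/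

theorem Subgroup.commutator_commutator_le_of_rotate {G : Type*} [Group G]
    {H₁ H₂ H₃ N : Subgroup G} [N.Normal]
    (h1 : ⁅⁅H₂, H₃⁆, H₁⁆ ≤ N) (h2 : ⁅⁅H₃, H₁⁆, H₂⁆ ≤ N) : ⁅⁅H₁, H₂⁆, H₃⁆ ≤ N := by
  have key : ∀ H : Subgroup G, H ≤ N ↔ H.map (QuotientGroup.mk' N) = ⊥ := fun H => by
    rw [Subgroup.map_eq_bot_iff, QuotientGroup.ker_mk']
  rw [key, Subgroup.map_commutator, Subgroup.map_commutator] at h1 h2 ⊢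
  exact Subgroup.commutator_commutator_eq_bot_of_rotate h1 h2

/-- The three subgroups lemma drives the induction. The `+ 1` arises because term `a`, counted from
`0`, is `γ_{a+1}`. -/
theorem Subgroup.commutator_lowerCentralSeries_le (G : Type*) [Group G] (b a : ℕ) :
    ⁅(⊤ : Subgroup G).lowerCentralSeries a, (⊤ : Subgroup G).lowerCentralSeries b⁆ ≤
      (⊤ : Subgroup G).lowerCentralSeries (a + b + 1) := by
  induction b generalizing a with
  | zero => exact le_rfl
  | succ b ih =>
    rw [Subgroup.commutator_comm, Subgroup.lowerCentralSeries_succ]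
    apply Subgroup.commutator_commutator_le_of_rotate
    · rw [Subgroup.commutator_comm ⊤]
      refine (ih (a + 1)).trans (le_of_eq ?_)
      congr 1
      omega
    · exact Subgroup.commutator_mono (ih a) le_rfl

/-- A descending sequence of normal subgroups `V 0 ≥ V 1 ≥ …` with `⁅V i, V j⁆ ≤ V (i + j)`. -/
structure IsCommutatorFiltration {G : Type*} [Group G] (V : ℕ → Subgroup G) : Prop where
  antitone : Antitone V
  commutator_le : ∀ i j, ⁅V i, V j⁆ ≤ V (i + j)

/-- Truncated subtraction makes `V 0 = V 1 = ⊤`, and `V i = γ_i` for `i ≥ 1`. -/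
theorem isCommutatorFiltration_lowerCentralSeries (G : Type*) [Group G] :
    IsCommutatorFiltration fun i => (⊤ : Subgroup G).lowerCentralSeries (i - 1) where
  antitone i j h := Subgroup.lowerCentralSeries_antitone _ (by omega)
  commutator_le i j := by
    rcases i with _ | i
    · simpa using Subgroup.commutator_le_right _ _
    · rcases j with _ | j
      · simpa using Subgroup.commutator_le_left _ _
      · refine (Subgroup.commutator_lowerCentralSeries_le G _ _).trans (le_of_eq ?_)
        congr 1
        omega

/-! ### Polynomial sequences and the `p`-th power of a product. -/

/-- The multiplicative forward difference of a sequence in a group. -/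
def fwdQuot {G : Type*} [Group G] (f : ℕ → G) : ℕ → G := fun n => (f n)⁻¹ * f (n + 1)

/-- Polynomial sequences in a group with respect to a filtration `V`, of depth at least `d`:
iterated differences of the sequence and of its inverse lie ever deeper in the filtration, and
become trivial eventually. -/
inductive IsPolySeq {G : Type*} [Group G] (V : ℕ → Subgroup G) : ℕ → (ℕ → G) → Prop
  | one (d : ℕ) : IsPolySeq V d 1
  | step {d : ℕ} {f : ℕ → G} (mem : ∀ n, f n ∈ V d) (fwd : IsPolySeq V (d + 1) (fwdQuot f))
      (fwd_inv : IsPolySeq V (d + 1) (fwdQuot f⁻¹)) : IsPolySeq V d f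

namespace IsPolySeq

variable {G : Type*} [Group G] {V : ℕ → Subgroup G} {d i j N : ℕ} {f g : ℕ → G}

theorem fwdQuot_one : fwdQuot (1 : ℕ → G) = 1 := by
  ext n
  simp [fwdQuot]

theorem mem (h : IsPolySeq V d f) (n : ℕ) : f n ∈ V d := by
  cases h with
  | one => exact one_mem _
  | step h _ _ => exact h n

theorem fwdQuot (h : IsPolySeq V d f) : IsPolySeq V (d + 1) (fwdQuot f) := by
  cases h with
  | one => rw [fwdQuot_one]; exact one _
  | step _ h _ => exact h

theorem inv (h : IsPolySeq V d f) : IsPolySeq V d f⁻¹ := by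
  cases h with
  | one => rw [inv_one]; exact one _
  | step h₁ h₂ h₃ => exact step (fun n => inv_mem (h₁ n)) h₃ (by rwa [inv_inv])

theorem anti (hV : Antitone V) (h : IsPolySeq V j f) (hij : i ≤ j) : IsPolySeq V i f := by
  induction h generalizing i with
  | one => exact one _
  | step h₁ _ _ ih₂ ih₃ =>
    exact step (fun n => hV hij (h₁ n)) (ih₂ (by omega)) (ih₃ (by omega))

theorem eq_one (hV : Antitone V) (hN : V N = ⊥) (h : IsPolySeq V d f) (hd : N ≤ d) : f = 1 := by
  ext n
  have := hV hd (h.mem n)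
  rwa [hN, Subgroup.mem_bot] at this

theorem fwdQuot_mul (f g : ℕ → G) :
    _root_.fwdQuot (f * g) = ⁅g⁻¹, _root_.fwdQuot f⁆ * _root_.fwdQuot f * _root_.fwdQuot g := by
  ext n
  simp only [_root_.fwdQuot, Pi.mul_apply, Pi.inv_apply, commutatorElement_def]
  group

theorem fwdQuot_commutatorElement (f g : ℕ → G) :
    _root_.fwdQuot ⁅f, g⁆ =
      (g * f * g⁻¹) * ⁅_root_.fwdQuot f, g⁆ * (g * f * g⁻¹)⁻¹ *
      ((g * f) * ⁅_root_.fwdQuot f, _root_.fwdQuot g⁆ * (g * f)⁻¹) *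
      (g * ⁅f, _root_.fwdQuot g⁆ * g⁻¹) := by
  ext n
  simp only [_root_.fwdQuot, Pi.mul_apply, Pi.inv_apply, commutatorElement_def]
  group

/-- Downward induction on depth: differencing gains one level, and `t` bounds the levels left before
`V N = ⊥`. Products and commutators must be treated together, since the difference of each involves
both. -/
theorem closure_properties (hV : IsCommutatorFiltration V) (hN : V N = ⊥) (t : ℕ) :
    (∀ i f g, N ≤ i + t → IsPolySeq V i f → IsPolySeq V i g → IsPolySeq V i (f * g)) ∧
    (∀ i j f g, N ≤ i + j + t → IsPolySeq V i f → IsPolySeq V j g →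
      IsPolySeq V (i + j) ⁅f, g⁆) := by
  have anti : ∀ {i j : ℕ} {f : ℕ → G}, IsPolySeq V j f → i ≤ j → IsPolySeq V i f :=
    fun h hij => h.anti hV.antitone hij
  induction t with
  | zero =>
    refine ⟨fun i f g hi hf hg => ?_, fun i j f g hij hf hg => ?_⟩
    · rw [hf.eq_one hV.antitone hN hi, hg.eq_one hV.antitone hN hi, mul_one]
      exact one _
    · have : ⁅f, g⁆ = 1 := by
        ext n
        have h := hV.antitone hij (hV.commutator_le i j
          (Subgroup.commutator_mem_commutator (hf.mem n) (hg.mem n)))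
        rwa [hN, Subgroup.mem_bot] at h
      rw [this]
      exact one _
  | succ t ih =>
    obtain ⟨ihm, ihc⟩ := ih
    constructor
    · have fwd : ∀ i f g, N ≤ i + (t + 1) → IsPolySeq V i f → IsPolySeq V i g →
          IsPolySeq V (i + 1) (_root_.fwdQuot (f * g)) := by
        intro i f g hi hf hg
        rw [fwdQuot_mul]
        refine ihm _ _ _ (by omega) (ihm _ _ _ (by omega) ?_ hf.fwdQuot) hg.fwdQuot
        exact anti (ihc _ _ _ _ (by omega) hg.inv hf.fwdQuot) (by omega)
      intro i f g hi hf hg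
      refine step (fun n => mul_mem (hf.mem n) (hg.mem n)) (fwd i f g hi hf hg) ?_
      rw [mul_inv_rev]
      exact fwd i _ _ hi hg.inv hf.inv
    · have fwd : ∀ i j f g, N ≤ i + j + (t + 1) → IsPolySeq V i f → IsPolySeq V j g →
          IsPolySeq V (i + j + 1) (_root_.fwdQuot ⁅f, g⁆) := by
        intro i j f g hij hf hg
        have conj : ∀ k h q, IsPolySeq V k h → IsPolySeq V (i + j + 1) q →
            IsPolySeq V (i + j + 1) (h * q * h⁻¹) := by
          intro k h q hh hq
          rw [show h * q * h⁻¹ = ⁅h, q⁆ * q by rw [commutatorElement_def]; group]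
          exact ihm _ _ _ (by omega) (anti (ihc _ _ _ _ (by omega) hh hq) (by omega)) hq
        have conj_mul : ∀ h k q : ℕ → G, (h * k) * q * (h * k)⁻¹ = h * (k * q * k⁻¹) * h⁻¹ := by
          intros
          group
        rw [fwdQuot_commutatorElement]
        refine ihm _ _ _ (by omega) (ihm _ _ _ (by omega) ?_ ?_) ?_
        · have := anti (i := i + j + 1) (ihc _ _ _ _ (by omega) hf.fwdQuot hg) (by omega)
          rw [conj_mul, conj_mul]
          refine conj _ _ _ hg (conj _ _ _ hf ?_)
          exact conj _ _ _ hg.inv this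
        · have := anti (i := i + j + 1) (ihc _ _ _ _ (by omega) hf.fwdQuot hg.fwdQuot) (by omega)
          rw [conj_mul]
          exact conj _ _ _ hg (conj _ _ _ hf this)
        · exact conj _ _ _ hg (anti (ihc _ _ _ _ (by omega) hf hg.fwdQuot) (by omega))
      intro i j f g hij hf hg
      refine step (fun n => hV.commutator_le i j
        (Subgroup.commutator_mem_commutator (hf.mem n) (hg.mem n))) (fwd i j f g hij hf hg) ?_
      rw [commutatorElement_inv, add_comm i j]
      exact fwd j i g f (by omega) hg hf

theorem mul (hV : IsCommutatorFiltration V) (hN : V N = ⊥) (hf : IsPolySeq V d f)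
    (hg : IsPolySeq V d g) : IsPolySeq V d (f * g) :=
  (closure_properties hV hN N).1 d f g (by omega) hf hg

theorem pow_choose {c : G} (hc : c ∈ V (d + i)) (hV : Antitone V) :
    IsPolySeq V d fun n => c ^ n.choose i := by
  induction i generalizing d c with
  | zero =>
    have key : ∀ c : G, _root_.fwdQuot (fun n : ℕ => c ^ n.choose 0) = 1 := fun c => by
      ext n
      simp [_root_.fwdQuot]
    refine step (fun n => pow_mem hc _) (by rw [key]; exact one _) ?_
    rw [show (fun n : ℕ => c ^ n.choose 0)⁻¹ = fun n : ℕ => c⁻¹ ^ n.choose 0 by ext n; simp, key]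
    exact one _
  | succ i ih =>
    have key : ∀ c : G, _root_.fwdQuot (fun n : ℕ => c ^ n.choose (i + 1)) =
        fun n : ℕ => c ^ n.choose i := fun c => by
      ext n
      rw [_root_.fwdQuot, Nat.choose_succ_succ', Nat.add_comm (n.choose i), pow_add,
        inv_mul_cancel_left]
    rw [← Nat.add_assoc, Nat.add_right_comm] at hc
    refine step (fun n => pow_mem (hV (by omega) hc) _) (by rw [key]; exact ih hc) ?_
    rw [show (fun n : ℕ => c ^ n.choose (i + 1))⁻¹ = fun n : ℕ => c⁻¹ ^ n.choose (i + 1) by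
      ext n; simp, key]
    exact ih (inv_mem hc)

/-- Here `f i` equals the `i`-th iterated difference of `f` at `0`. -/
theorem apply_mem_of_forall_lt_eq_one (h : IsPolySeq V d f) (hf : ∀ k < i, f k = 1) :
    f i ∈ V (d + i) := by
  induction i generalizing d f with
  | zero => exact h.mem 0
  | succ i ih =>
    have := ih h.fwdQuot fun k hk => by
      rw [_root_.fwdQuot, hf k (by omega), hf (k + 1) (by omega), inv_one, mul_one]
    rwa [_root_.fwdQuot, hf i (by omega), inv_one, one_mul, Nat.add_right_comm] at this

/-- Dividing by `f(m) ^ (n choose m)` removes the first Taylor coefficient. The value at `p` is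
unchanged, because `p` divides `p choose m` and `f(m) ^ p = 1`. -/
theorem apply_prime_eq_one (hV : IsCommutatorFiltration V) {p m : ℕ} (hp : p.Prime)
    (hVp : V p = ⊥) (hm : 0 < m) (hpow : ∀ c ∈ V m, c ^ p = 1) (h : IsPolySeq V 0 f)
    (hmp : m ≤ p) (hf : ∀ k < m, f k = 1) : f p = 1 := by
  induction hmp using Nat.decreasingInduction generalizing f with
  | self =>
    have := h.apply_mem_of_forall_lt_eq_one hf
    rwa [zero_add, hVp, Subgroup.mem_bot] at this
  | of_succ m hmp ih =>
    have hmem := h.apply_mem_of_forall_lt_eq_one hf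
    have hg := h.mul hV hVp (pow_choose hmem hV.antitone).inv
    have := ih (by omega) (fun c hc => hpow c (hV.antitone (by omega) hc)) hg fun k hk => by
      rcases Nat.lt_succ_iff_lt_or_eq.mp hk with hk | rfl
      · simp [hf k hk, Nat.choose_eq_zero_of_lt hk]
      · simp
    obtain ⟨a, ha⟩ := hp.dvd_choose_self hm.ne' hmp
    rw [zero_add] at hmem
    simpa [ha, pow_mul, hpow _ hmem] using this

end IsPolySeq

theorem mul_pow_prime_of_commutator_pow_eq_one {G : Type*} [Group G] {p : ℕ} (hp : p.Prime)
    (hG : (⊤ : Subgroup G).lowerCentralSeries (p - 1) = ⊥)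
    (hpow : ∀ c ∈ commutator G, c ^ p = 1) (x y : G) : (x * y) ^ p = x ^ p * y ^ p := by
  have hV := isCommutatorFiltration_lowerCentralSeries G
  have hseq : ∀ z : G, IsPolySeq (fun i => (⊤ : Subgroup G).lowerCentralSeries (i - 1)) 0
      fun n => z ^ n := fun z => by
    simpa using IsPolySeq.pow_choose (d := 0) (i := 1) (c := z) (by simp) hV.antitone
  -- The sequence `(xy)^n y^{-n} x^{-n}` is trivial at `0` and `1`, so only coefficients in `V 2 =
  -- G'` and deeper occur.
  have h := ((hseq (x * y)).mul hV hG (hseq y).inv).mul hV hG (hseq x).inv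
  have := h.apply_prime_eq_one hV (m := 2) hp hG two_pos hpow hp.two_le
    fun k hk => by interval_cases k <;> simp
  simpa [mul_inv_eq_one, mul_inv_eq_iff_eq_mul] using this

/-! ### The subgroup `⟨x⟩G'` and torsion in class less than `p`. -/

theorem Subgroup.top_lowerCentralSeries_eq_bot_of_coe {G : Type*} [Group G] {K : Subgroup G} {n : ℕ}
    (h : K.lowerCentralSeries n = ⊥) : (⊤ : Subgroup K).lowerCentralSeries n = ⊥ := by
  rwa [← Subgroup.top_subtype_lowerCentralSeries,
    Subgroup.map_eq_bot_iff_of_injective _ K.subtype_injective] at h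

theorem Subgroup.normal_zpowers_sup_commutator {G : Type*} [Group G] (x : G) :
    (Subgroup.zpowers x ⊔ _root_.commutator G).Normal :=
  Subgroup.Normal.of_commutator_le _ le_sup_right

/-- Modulo `γ_3(G)` the subgroup `G'` is central and `⟨x⟩` is cyclic, so `⟨x⟩G'` is abelian there.
Its class is thus one below that of `G` once the latter is at least `2`. -/
theorem Subgroup.lowerCentralSeries_zpowers_sup_commutator_le {G : Type*} [Group G] (x : G)
    (i : ℕ) : (Subgroup.zpowers x ⊔ _root_.commutator G).lowerCentralSeries (i + 1) ≤
      (⊤ : Subgroup G).lowerCentralSeries (i + 2) := by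
  induction i with
  | zero =>
    rw [Subgroup.lowerCentralSeries_succ, Subgroup.lowerCentralSeries_zero, Subgroup.commutator_le]
    let π := QuotientGroup.mk' ((⊤ : Subgroup G).lowerCentralSeries 2)
    have hker : ∀ g, g ∈ (⊤ : Subgroup G).lowerCentralSeries 2 ↔ π g = 1 := fun g =>
      (QuotientGroup.eq_one_iff g).symm
    have hcentral : ∀ d ∈ _root_.commutator G, ∀ g, Commute (π d) (π g) := fun d hd g => by
      rw [← commutatorElement_eq_one_iff_commute, ← map_commutatorElement, ← hker]
      exact Subgroup.commutator_mem_commutator hd (Subgroup.mem_top g)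
    intro a ha b hb
    obtain ⟨a', ha', d, hd, rfl⟩ := Subgroup.mem_sup_of_normal_right.mp ha
    obtain ⟨b', hb', e, he, rfl⟩ := Subgroup.mem_sup_of_normal_right.mp hb
    obtain ⟨m, rfl⟩ := ha'
    obtain ⟨n, rfl⟩ := hb'
    rw [hker, map_commutatorElement, commutatorElement_eq_one_iff_commute]
    simp only [map_mul]
    refine Commute.mul_left (Commute.mul_right ?_ (hcentral e he _).symm) ?_
    · exact (Commute.zpow_zpow_self x m n).map π
    · rw [← map_mul]
      exact hcentral d hd _
  | succ i ih => exact Subgroup.commutator_mono ih le_top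

/-- The elements of `K` of order dividing `n`, as a subgroup, if they are closed under
multiplication. -/
def Subgroup.powEqOne {G : Type*} [Group G] (K : Subgroup G) (n : ℕ)
    (h : ∀ x ∈ K, ∀ y ∈ K, x ^ n = 1 → y ^ n = 1 → (x * y) ^ n = 1) : Subgroup G where
  carrier := {g | g ∈ K ∧ g ^ n = 1}
  one_mem' := ⟨one_mem _, one_pow n⟩
  mul_mem' ha hb := ⟨mul_mem ha.1 hb.1, h _ ha.1 _ hb.1 ha.2 hb.2⟩
  inv_mem' ha := ⟨inv_mem ha.1, by rw [inv_pow, ha.2, inv_one]⟩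

theorem Subgroup.normal_powEqOne {G : Type*} [Group G] (K : Subgroup G) [hK : K.Normal] (n : ℕ)
    (h : ∀ x ∈ K, ∀ y ∈ K, x ^ n = 1 → y ^ n = 1 → (x * y) ^ n = 1) : (K.powEqOne n h).Normal where
  conj_mem g hg a := ⟨hK.conj_mem g hg.1 a, by rw [conj_pow, hg.2, mul_one, mul_inv_cancel]⟩

/-- For `t ∈ T`, `⁅t, b⁆` is the product of `t` and a conjugate of `t⁻¹`, both in `⟨t⟩G'`.
Commutator identities extend this from `T` to all of `G`. -/
theorem pow_eq_one_of_mem_commutator {G : Type*} [Group G] {n : ℕ} {T : Set G}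
    (hT : Subgroup.closure T = ⊤) (hTn : ∀ t ∈ T, t ^ n = 1)
    (h : ∀ z : G, ∀ x ∈ Subgroup.zpowers z ⊔ commutator G,
      ∀ y ∈ Subgroup.zpowers z ⊔ commutator G, x ^ n = 1 → y ^ n = 1 → (x * y) ^ n = 1)
    {g : G} (hg : g ∈ commutator G) : g ^ n = 1 := by
  let D := (commutator G).powEqOne n fun x hx y hy =>
    h 1 x (Subgroup.mem_sup_right hx) y (Subgroup.mem_sup_right hy)
  have hD : D.Normal := Subgroup.normal_powEqOne _ _ _
  have hcomm : ∀ a ∈ Subgroup.closure T, ∀ b, ⁅a, b⁆ ∈ D := by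
    intro a ha
    induction ha using Subgroup.closure_induction with
    | mem t ht =>
      intro b
      have htb : ⁅t, b⁆ ∈ commutator G :=
        Subgroup.commutator_mem_commutator (Subgroup.mem_top t) (Subgroup.mem_top b)
      refine ⟨htb, ?_⟩
      have ht' : t ∈ Subgroup.zpowers t ⊔ commutator G :=
        Subgroup.mem_sup_left (Subgroup.mem_zpowers t)
      have heq : b * t⁻¹ * b⁻¹ = t⁻¹ * ⁅t, b⁆ := by rw [commutatorElement_def]; group
      have := h t t ht' (b * t⁻¹ * b⁻¹)
        (heq ▸ mul_mem (inv_mem ht') (Subgroup.mem_sup_right htb)) (hTn t ht)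
        (by rw [conj_pow, inv_pow, hTn t ht, inv_one, mul_one, mul_inv_cancel])
      rwa [heq, mul_inv_cancel_left] at this
    | one => intro b; rw [commutatorElement_one_left]; exact one_mem D
    | mul a b _ _ iha ihb =>
      intro c
      rw [show ⁅a * b, c⁆ = a * ⁅b, c⁆ * a⁻¹ * ⁅a, c⁆ by simp only [commutatorElement_def]; group]
      exact mul_mem (hD.conj_mem _ (ihb c) a) (iha c)
    | inv a _ ih =>
      intro b
      rw [commutatorElement_inv_left, ← commutatorElement_inv]
      simpa using hD.conj_mem _ (inv_mem (ih b)) a⁻¹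
  have hle : commutator G ≤ D :=
    Subgroup.commutator_le.mpr fun a _ b _ => hcomm a (hT ▸ Subgroup.mem_top a) b
  exact (hle hg).2

theorem mul_pow_prime_eq_one {p : ℕ} (hp : p.Prime) {c : ℕ} (hc : c < p) {G : Type*} [Group G]
    (hG : (⊤ : Subgroup G).lowerCentralSeries c = ⊥) {x y : G} (hx : x ^ p = 1) (hy : y ^ p = 1) :
    (x * y) ^ p = 1 := by
  induction c using Nat.strong_induction_on generalizing G with
  | _ c ih =>
    rcases c with _ | _ | c
    · rw [Subgroup.lowerCentralSeries_zero] at hG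
      have hz : ∀ z : G, z = 1 := fun z => by
        rw [← Subgroup.mem_bot, ← hG]
        exact Subgroup.mem_top z
      exact hz _
    · have : IsMulCommutative G := (commutator_eq_bot_iff G).mp hG
      rw [Commute.mul_pow (this.is_comm.comm x y), hx, hy, one_mul]
    -- Passing to `⟨x, y⟩` gives a group generated by elements killed by `p`; induction on the
    -- class, applied to `⟨z⟩H'`, then shows that `H'` has exponent dividing `p`.
    · let H := Subgroup.closure {x, y}
      let T : Set H := Subtype.val ⁻¹' {x, y}
      have hT : Subgroup.closure T = ⊤ := Subgroup.closure_closure_coe_preimage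
      have hTp : ∀ t ∈ T, t ^ p = 1 := by
        rintro ⟨t, _⟩ (ht : t = x ∨ t = y)
        exact Subtype.ext (ht.elim (fun h => h ▸ hx) (fun h => h ▸ hy))
      have hH : (⊤ : Subgroup H).lowerCentralSeries (c + 2) = ⊥ :=
        Subgroup.top_lowerCentralSeries_eq_bot_of_coe
          (eq_bot_iff.mpr (hG ▸ Subgroup.lowerCentralSeries_mono _ le_top))
      have hcomm : ∀ g ∈ commutator H, g ^ p = 1 := fun g hg => by
        refine pow_eq_one_of_mem_commutator hT hTp (fun z a ha b hb hap hbp => ?_) hg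
        have hK := Subgroup.top_lowerCentralSeries_eq_bot_of_coe (eq_bot_iff.mpr
          (hH ▸ Subgroup.lowerCentralSeries_zpowers_sup_commutator_le z c))
        exact congrArg Subtype.val (ih (c + 1) (by omega) (by omega) hK
          (x := ⟨a, ha⟩) (y := ⟨b, hb⟩) (Subtype.ext hap) (Subtype.ext hbp))
      have hH' : (⊤ : Subgroup H).lowerCentralSeries (p - 1) = ⊥ :=
        eq_bot_iff.mpr (hH ▸ Subgroup.lowerCentralSeries_antitone _ (by omega))
      have := mul_pow_prime_of_commutator_pow_eq_one hp hH' hcomm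
        ⟨x, Subgroup.subset_closure (by simp)⟩ ⟨y, Subgroup.subset_closure (by simp)⟩
      simpa [hx, hy] using congrArg Subtype.val this

theorem mul_pow_prime_pow_eq_one {p : ℕ} (hp : p.Prime) {c : ℕ} (hc : c < p) (e : ℕ) {G : Type*}
    [Group G] (hG : (⊤ : Subgroup G).lowerCentralSeries c = ⊥) {x y : G} (hx : x ^ p ^ e = 1)
    (hy : y ^ p ^ e = 1) : (x * y) ^ p ^ e = 1 := by
  induction e generalizing G with
  | zero =>
    rw [pow_zero, pow_one] at *
    rw [hx, hy, one_mul]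
  | succ e ih =>
    -- Modulo the `p`-torsion subgroup, the exponent `p ^ (e + 1)` drops to `p ^ e`.
    let Ω := (⊤ : Subgroup G).powEqOne p fun _ _ _ _ => mul_pow_prime_eq_one hp hc hG
    have hΩ : Ω.Normal := Subgroup.normal_powEqOne _ _ _
    have hmem : ∀ g : G, g ^ p ^ (e + 1) = 1 ↔ (QuotientGroup.mk' Ω g) ^ p ^ e = 1 := fun g => by
      rw [← map_pow, QuotientGroup.mk'_apply, QuotientGroup.eq_one_iff, pow_succ, pow_mul]
      exact (and_iff_right (Subgroup.mem_top _)).symm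
    have hQ : (⊤ : Subgroup (G ⧸ Ω)).lowerCentralSeries c = ⊥ := by
      rw [← Subgroup.map_top_of_surjective _ (QuotientGroup.mk'_surjective Ω),
        ← Subgroup.map_lowerCentralSeries, hG, Subgroup.map_bot]
    rw [hmem] at hx hy ⊢
    rw [map_mul]
    exact ih hQ hx hy

theorem pow_eq_one_of_mem_normalClosure {p : ℕ} (hp : p.Prime) (e : ℕ) {G : Type*} [Group G]
    (hG : (⊤ : Subgroup G).lowerCentralSeries p = ⊥) {x g : G} (hx : x ^ p ^ e = 1)
    (hg : g ∈ Subgroup.normalClosure {x}) : g ^ p ^ e = 1 := by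
  obtain ⟨c, rfl⟩ : ∃ c, p = c + 2 := ⟨p - 2, by have := hp.two_le; omega⟩
  have hK := Subgroup.top_lowerCentralSeries_eq_bot_of_coe (eq_bot_iff.mpr
    (hG ▸ Subgroup.lowerCentralSeries_zpowers_sup_commutator_le x c))
  have := Subgroup.normal_zpowers_sup_commutator x
  let D := (Subgroup.zpowers x ⊔ commutator G).powEqOne ((c + 2) ^ e) fun a ha b hb hae hbe =>
    congrArg Subtype.val (mul_pow_prime_pow_eq_one hp (Nat.lt_succ_self _) e hK
      (x := ⟨a, ha⟩) (y := ⟨b, hb⟩) (Subtype.ext hae) (Subtype.ext hbe))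
  have hD : D.Normal := Subgroup.normal_powEqOne _ _ _
  have hle : Subgroup.normalClosure {x} ≤ D := Subgroup.normalClosure_le_normal <|
    Set.singleton_subset_iff.mpr ⟨Subgroup.mem_sup_left (Subgroup.mem_zpowers x), hx⟩
  exact (hle hg).2

/-! ### From generating sets to series and back. -/

theorem isPartialComplementIn_normalClosure {G : Type*} [Group G] {x : G} {S : Set G}
    (hx : x ∉ Subgroup.closure S) {H : Subgroup G} (hH : Subgroup.closure (insert x S) = H)
    (hxH : x ∈ H) : IsPartialComplementIn H
      ((Subgroup.normalClosure {(⟨x, hxH⟩ : H)}).map H.subtype) (Subgroup.closure S) := by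
  set N := Subgroup.normalClosure {(⟨x, hxH⟩ : H)}
  have hxN : x ∈ N.map H.subtype := ⟨⟨x, hxH⟩, Subgroup.subset_normalClosure rfl, rfl⟩
  have hUH : Subgroup.closure S ≤ H := hH ▸ Subgroup.closure_mono (Set.subset_insert x S)
  refine ⟨Subgroup.map_subtype_le N, ?_, SetLike.lt_iff_le_and_exists.mpr ⟨hUH, x, hxH, hx⟩, ?_⟩
  · rw [Subgroup.subgroupOf, Subgroup.comap_map_eq_self_of_injective H.subtype_injective]
    exact Subgroup.normalClosure_normal
  · have hsup : N ⊔ (Subgroup.closure S).subgroupOf H = ⊤ := by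
      rw [eq_top_iff, ← Subgroup.map_subtype_le_map_subtype, Subgroup.map_sup,
        Subgroup.map_subgroupOf_eq_of_le hUH, ← MonoidHom.range_eq_map, Subgroup.range_subtype]
      conv_lhs => rw [← hH]
      rw [Subgroup.closure_le]
      exact Set.insert_subset (Subgroup.mem_sup_left hxN)
        (Subgroup.subset_closure.trans (SetLike.coe_subset_coe.mpr le_sup_right))
    ext h
    constructor
    · rintro ⟨a, ha, b, hb, rfl⟩
      exact mul_mem (Subgroup.map_subtype_le N ha) (hUH hb)
    · intro hh
      obtain ⟨a, ha, b, hb, hab⟩ := Subgroup.mem_sup_of_normal_left.mp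
        (hsup ▸ Subgroup.mem_top (⟨h, hh⟩ : H))
      exact ⟨a, ⟨a, ha, rfl⟩, b, hb, congrArg Subtype.val hab⟩

theorem exists_partialComplementIn_sequence {p : ℕ} (hp : p.Prime) (e : ℕ) {G : Type*} [Group G]
    [Group.IsNilpotent G] (hG : (⊤ : Subgroup G).lowerCentralSeries p = ⊥) (S : Finset G)
    (hS : ∀ x ∈ S, x ^ p ^ e = 1) :
    ∃ (s : ℕ) (grp ker : ℕ → Subgroup G), grp 0 = Subgroup.closure S ∧ grp s = ⊥ ∧
      ∀ i < s, IsPartialComplementIn (grp i) (ker i) (grp (i + 1)) ∧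
        Monoid.exponent (ker i) ∣ p ^ e := by
  classical
  induction S using Finset.induction with
  | empty => exact ⟨0, fun _ => ⊥, fun _ => ⊥, by simp, rfl, by simp⟩
  | insert x S _ ih =>
    obtain ⟨s, grp, ker, h0, hs, h⟩ := ih fun y hy => hS y (Finset.mem_insert_of_mem hy)
    rw [Finset.coe_insert]
    -- A redundant generator is skipped, since its complement would not be proper.
    by_cases hx : x ∈ Subgroup.closure (S : Set G)
    · refine ⟨s, grp, ker, h0.trans (le_antisymm (Subgroup.closure_mono (Set.subset_insert x _)) ?_),
        hs, h⟩
      exact (Subgroup.closure_le _).mpr (Set.insert_subset hx Subgroup.subset_closure)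
    · obtain ⟨H, hH⟩ : ∃ H, Subgroup.closure (insert x (S : Set G)) = H := ⟨_, rfl⟩
      have hxH : x ∈ H := hH ▸ Subgroup.subset_closure (Set.mem_insert x _)
      have hlcs : (⊤ : Subgroup H).lowerCentralSeries p = ⊥ :=
        Subgroup.top_lowerCentralSeries_eq_bot_of_coe
          (eq_bot_iff.mpr (hG ▸ Subgroup.lowerCentralSeries_mono _ le_top))
      refine ⟨s + 1, fun i => i.casesOn H grp,
        fun i => i.casesOn ((Subgroup.normalClosure {(⟨x, hxH⟩ : H)}).map H.subtype) ker,
        hH.symm, hs, ?_⟩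
      rintro (_ | i) hi
      · refine ⟨?_, ?_⟩
        · change IsPartialComplementIn H _ (grp 0)
          rw [h0]
          exact isPartialComplementIn_normalClosure hx hH hxH
        · refine Monoid.exponent_dvd_of_forall_pow_eq_one ?_
          rintro ⟨_, g, hg, rfl⟩
          have := pow_eq_one_of_mem_normalClosure hp e hlcs
            (Subtype.ext (hS x (Finset.mem_insert_self x S))) hg
          exact Subtype.ext (congrArg H.subtype this)
      · exact h i (by omega)

theorem exists_partialComplementSeries {p : ℕ} (hp : p.Prime) {e : ℕ} {G : Type*} [Group G]
    [Group.IsNilpotent G] (hG : (⊤ : Subgroup G).lowerCentralSeries p = ⊥) {S : Finset G}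
    (hS : Subgroup.closure (S : Set G) = ⊤) (hSp : ∀ x ∈ S, x ^ p ^ e = 1) :
    ∃ σ : PartialComplementSeries G, σ.lcmExponent ∣ p ^ e := by
  obtain ⟨s, grp, ker, h0, hs, h⟩ := exists_partialComplementIn_sequence hp e hG S hSp
  refine ⟨⟨s, grp, fun i => ker (i - 1), h0.trans hS, hs, fun i _ => inferInstance, fun i hi => (h i hi).1⟩, ?_⟩
  refine Finset.lcm_dvd fun i hi => ?_
  obtain ⟨h1, h2⟩ := Finset.mem_Icc.mp hi
  obtain ⟨i, rfl⟩ := Nat.exists_eq_add_of_le' h1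
  exact (h i h2).2

theorem PartialComplementSeries.lcmExponent_pos {G : Type*} [Group G] [Finite G]
    (σ : PartialComplementSeries G) : 0 < σ.lcmExponent := by
  refine Nat.pos_of_ne_zero fun h => ?_
  obtain ⟨i, _, hi⟩ := Finset.lcm_eq_zero_iff.mp h
  exact Monoid.exponent_ne_zero_of_finite hi

/-- The groups `N_i` of a series of partial complements generate `G`. -/
theorem PartialComplementSeries.exists_generatingLcms_dvd {G : Type*} [Group G] [Finite G]
    (σ : PartialComplementSeries G) : ∃ n ∈ generatingLcms G, n ∣ σ.lcmExponent := by
  classical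
  have := Fintype.ofFinite G
  -- This set contains every `N_i`, and `G_{i-1} = N_i G_i`; descending from `G_s = 1` to `G_0 = G`
  -- shows that it generates.
  let S : Finset G := {g | g ^ σ.lcmExponent = 1}
  have hle : ∀ i ≤ σ.length, σ.grp i ≤ Subgroup.closure (S : Set G) := fun i hi => by
    induction hi using Nat.decreasingInduction with
    | self => rw [σ.grp_length]; exact bot_le
    | of_succ i hi ih =>
      intro g hg
      rw [← SetLike.mem_coe, ← (σ.isPartialComplementIn i hi).mul_eq] at hg
      obtain ⟨a, ha, b, hb, rfl⟩ := hg
      refine mul_mem (Subgroup.subset_closure ?_) (ih hb)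
      have hexp : Monoid.exponent (σ.ker (i + 1)) ∣ σ.lcmExponent :=
        Finset.dvd_lcm (f := fun i => Monoid.exponent (σ.ker i))
          (Finset.mem_Icc.mpr ⟨by omega, by omega⟩)
      have := Monoid.exponent_dvd_iff_forall_pow_eq_one.mp hexp ⟨a, ha⟩
      simpa [S] using congrArg Subtype.val this
  refine ⟨S.lcm orderOf, ⟨S, ?_, rfl⟩, Finset.lcm_dvd fun g hg => ?_⟩
  · rw [eq_top_iff, ← σ.grp_zero]
    exact hle 0 (Nat.zero_le _)
  · exact orderOf_dvd_of_pow_eq_one (by simpa [S] using hg)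

theorem generatingLcms_nonempty (G : Type*) [Group G] [Finite G] : (generatingLcms G).Nonempty := by
  have := Fintype.ofFinite G
  exact ⟨_, Finset.univ, by simp, rfl⟩

theorem theorem4p5 (p : ℕ) (hp : p.Prime) (G : Type*) [Group G] [Finite G]
    (hG : IsPGroup p G) (hc : Group.nilpotencyClass G ≤ p) :
    shafarevichConstant G = generatorExponent G := by
  have : Fact p.Prime := ⟨hp⟩
  have hnil : Group.IsNilpotent G := hG.isNilpotent
  have hlcs := Subgroup.lowerCentralSeries_eq_bot_iff_nilpotencyClass_le.mpr hc
  obtain ⟨S, hS, hSlcm⟩ := Nat.sInf_mem (generatingLcms_nonempty G)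
  obtain ⟨k, hk⟩ := IsPGroup.iff_card.mp hG
  -- The lcm of the orders divides `|G| = p ^ k`, so it is itself a power of `p`.
  obtain ⟨e, -, he⟩ := (Nat.dvd_prime_pow hp).mp
    (hk ▸ Finset.lcm_dvd fun g _ => orderOf_dvd_natCard g : S.lcm orderOf ∣ p ^ k)
  obtain ⟨σ, hσ⟩ := exists_partialComplementSeries hp hlcs hS fun x hx =>
    orderOf_dvd_iff_pow_eq_one.mp (he ▸ Finset.dvd_lcm hx)
  apply le_antisymm
  · calc shafarevichConstant G ≤ σ.lcmExponent := Nat.sInf_le ⟨σ, rfl⟩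
      _ ≤ p ^ e := Nat.le_of_dvd (pow_pos hp.pos e) hσ
      _ = generatorExponent G := he.symm.trans hSlcm
  · obtain ⟨τ, hτ⟩ := Nat.sInf_mem (Set.range_nonempty_iff_nonempty.mpr ⟨σ⟩ :
      (Set.range (PartialComplementSeries.lcmExponent (G := G))).Nonempty)
    obtain ⟨n, hn, hdvd⟩ := τ.exists_generatingLcms_dvd
    calc generatorExponent G ≤ n := Nat.sInf_le hn
      _ ≤ τ.lcmExponent := Nat.le_of_dvd τ.lcmExponent_pos hdvd
      _ = shafarevichConstant G := hτ
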